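/- Formulas are propositional formulas in the connectives $\wedge,\vee,\to,\neg$ over countably many variables. Let $\varphi_1=\neg p\vee\neg\neg p$ and, for $k>1$, $$\varphi_k=\bigvee_{1\le i\neq j\le k}(\neg p_i\to\neg p_j)\ \vee\ \neg(\neg p_1\wedge\dots\wedge\neg p_k).$$ Let $\mathsf{IPC}+\varphi_k$ be the deductive closure of the intuitionistic propositional calculus together with all substitution instances of $\varphi_k$. A Brouwer algebra is a bounded distributive lattice $(L,+,\times,0,1)$ ($+$ is join, $\times$ is meet) in which, for all $a,b$, there is a least $c$ with $b\le a+c$; it is denoted $a\to b$, and $\neg a=a\to 1$. The algebra $L$ satisfies a formula $\sigma$ if, for every assignment of elements of $L$ to the variables, $\sigma$ takes the value $0$ when $\vee,\wedge,\to,\neg$ are interpreted as $\times,+,\to,\neg$, respectively. **Theorem.** Let $k\ge 1$ and let $n$ be the least positive integer with $\binom{n}{\lfloor n/2\rfloor}\ge k$. Then $\mathsf{IPC}+\varphi_k$ is complete with respect to the class of all finite Brouwer algebras $L$ in which $0$ is meet-irreducible (that is, $0\neq 1$, and $a\times b=0$ implies $a=0$ or $b=0$) and which have at most $n$ coatoms: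 a formula $\sigma$ is derivable in $\mathsf{IPC}+\varphi_k$ if and only if every algebra in this class satisfies $\sigma$. -/

import Mathlib

universe u

namespace IPL

/-- Propositional formulas in the connectives `∧`, `∨`, `→`, `¬`, over the variables
`var 0, var 1, …`. -/
inductive Formula : Type
  | var : ℕ → Formula
  | and : Formula → Formula → Formula
  | or : Formula → Formula → Formula
  | imp : Formula → Formula → Formula
  | neg : Formula → Formula

namespace Formula

/-- Simultaneous substitution of the formula `s i` for every variable `var i`. -/
def subst (s : ℕ → Formula) : Formula → Formula
  | var i => s i
  | and A B => and (A.subst s) (B.subst s)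
  | or A B => or (A.subst s) (B.subst s)
  | imp A B => imp (A.subst s) (B.subst s)
  | neg A => neg (A.subst s)

/-- Value of a formula in a Brouwer algebra. A Brouwer algebra is a co-Heyting algebra in the
sense of Mathlib: `b \ a ≤ c ↔ b ≤ a ⊔ c`, so that the Brouwer implication `a → b`, the least `c`
with `b ≤ a ⊔ c`, is `b \ a`, and the Brouwer negation `a → 1` is `⊤ \ a = ￢a`. Truth is dual to
that in a Heyting algebra: `∧` is the join, `∨` is the meet. -/
def eval {L : Type*} [CoheytingAlgebra L] (v : ℕ → L) : Formula → L
  | var i => v i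
  | and A B => A.eval v ⊔ B.eval v
  | or A B => A.eval v ⊓ B.eval v
  | imp A B => B.eval v \ A.eval v
  | neg A => ￢(A.eval v)

end Formula

open Formula

/-- The Brouwer algebra `L` satisfies `A`: under every assignment of elements of `L` to the
variables, `A` takes the value `0`. -/
def Satisfies (L : Type*) [CoheytingAlgebra L] (A : Formula) : Prop :=
  ∀ v : ℕ → L, A.eval v = ⊥

/-- `Provable X A`: the formula `A` belongs to the logic `IPC + X`, the deductive closure (under
modus ponens) of the intuitionistic propositional calculus and all substitution instances of
formulas in `X`. In particular `Provable ∅` is `IPC` itself. -/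
inductive Provable (X : Set Formula) : Formula → Prop
  | imp_weaken (A B : Formula) : Provable X (imp A (imp B A))
  | imp_distrib (A B C : Formula) :
      Provable X (imp (imp A (imp B C)) (imp (imp A B) (imp A C)))
  | and_left (A B : Formula) : Provable X (imp (and A B) A)
  | and_right (A B : Formula) : Provable X (imp (and A B) B)
  | and_intro (A B : Formula) : Provable X (imp A (imp B (and A B)))
  | or_left (A B : Formula) : Provable X (imp A (or A B))
  | or_right (A B : Formula) : Provable X (imp B (or A B))
  | or_elim (A B C : Formula) :
      Provable X (imp (imp A C) (imp (imp B C) (imp (or A B) C)))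
  | neg_intro (A B : Formula) : Provable X (imp (imp A B) (imp (imp A (neg B)) (neg A)))
  | neg_elim (A B : Formula) : Provable X (imp (neg A) (imp A B))
  | extra (A : Formula) (s : ℕ → Formula) : A ∈ X → Provable X (A.subst s)
  | mp (A B : Formula) : Provable X (imp A B) → Provable X A → Provable X B

/-- The conjunction `¬p₁ ∧ … ∧ ¬pₖ` for `k ≥ 1`, where `pᵢ` is `var (i - 1)`. -/
def negConj (k : ℕ) : Formula :=
  (List.range (k - 1)).foldr (fun i A => and (neg (var i)) A) (neg (var (k - 1)))

/-- The formulas `¬pᵢ → ¬pⱼ` with `1 ≤ i, j ≤ k` and `i ≠ j`, where `pᵢ` is `var (i - 1)`. -/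
def negImps (k : ℕ) : List Formula :=
  ((List.range k ×ˢ List.range k).filter (fun q => q.1 ≠ q.2)).map
    (fun q => imp (neg (var q.1)) (neg (var q.2)))

/-- `φ₁ = ¬p ∨ ¬¬p`, and for `k > 1`,
`φₖ = ⋁_{i ≠ j} (¬pᵢ → ¬pⱼ) ∨ ¬(¬p₁ ∧ … ∧ ¬pₖ)`. (The value at `k = 0` is irrelevant.) -/
def phi (k : ℕ) : Formula :=
  if k ≤ 1 then or (neg (var 0)) (neg (neg (var 0)))
  else (negImps k).foldr or (neg (negConj k))

end IPL

/-! Coatoms (maximal ideals) decide negations classically: `￢a` lies below a coatom exactly when `a`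
does not. Both directions thus reduce to Sperner's theorem on antichains of sets of coatoms.
Soundness: if `phi k` with `2 ≤ k` fails at `v`, the sets of coatoms above `￢v i` form an antichain
of size `k` with a common member. Removing it and applying Sperner leaves at least `n` other coatoms
(`le_choose_of_eval_phi_ne_bot`). Completeness: if `A` is underivable, some prime ideal `P` of the
Lindenbaum algebra omits its value. Above `P` there are at most `n` maximal ideals, as `n + 1` of
them would carry an antichain refuting `phi k` (`not_injective_of_satisfies_phi`). The theories of
the primes above `P`, restricted to subformulas of `A`, form a finite rooted Kripke frame. Its
algebra of up-sets refutes `A` (`mem_eval_iff`), has meet-irreducible `⊥`, and has at most `n`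
coatoms because each comes from a maximal ideal above `P`. -/

namespace IPL

open Formula Order

/-! ### Derived rules of intuitionistic propositional calculus -/

namespace Provable

variable {X : Set Formula} {A B C : Formula}

theorem weaken (h : Provable X B) : Provable X (imp A B) :=
  mp _ _ (imp_weaken B A) h

theorem imp_mp (h₁ : Provable X (imp C (imp A B))) (h₂ : Provable X (imp C A)) :
    Provable X (imp C B) :=
  mp _ _ (mp _ _ (imp_distrib _ _ _) h₁) h₂

theorem imp_refl (A : Formula) : Provable X (imp A A) :=
  imp_mp (imp_weaken A (imp A A)) (imp_weaken A A)

theorem imp_trans (h₁ : Provable X (imp A B)) (h₂ : Provable X (imp B C)) :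
    Provable X (imp A C) :=
  imp_mp h₂.weaken h₁

theorem imp_and (h₁ : Provable X (imp C A)) (h₂ : Provable X (imp C B)) :
    Provable X (imp C (and A B)) :=
  imp_mp (imp_trans h₁ (and_intro A B)) h₂

theorem or_imp (h₁ : Provable X (imp A C)) (h₂ : Provable X (imp B C)) :
    Provable X (imp (or A B) C) :=
  mp _ _ (mp _ _ (or_elim _ _ _) h₁) h₂

theorem imp_imp_mono (h : Provable X (imp B C)) : Provable X (imp (imp A B) (imp A C)) :=
  mp _ _ (imp_distrib _ _ _) h.weaken

theorem imp_imp_iff : Provable X (imp C (imp A B)) ↔ Provable X (imp (and A C) B) := by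
  constructor
  · intro h
    exact imp_mp (imp_trans (and_right A C) h) (and_left A C)
  · intro h
    have h' : Provable X (imp (and C A) B) :=
      imp_trans (imp_and (and_right C A) (and_left C A)) h
    exact imp_trans (and_intro C A) h'.imp_imp_mono

/-- The language has no constant for falsum; `and B (neg B)` stands in for it. This is what
identifies `⊤ \ a` with `￢a` in the Lindenbaum algebra. -/
theorem neg_imp_falsum : Provable X (imp (neg A) (imp A (and B (neg B)))) :=
  neg_elim _ _

theorem falsum_imp : Provable X (imp (and B (neg B)) A) :=
  imp_mp (imp_trans (and_right _ _) (neg_elim _ _)) (and_left _ _)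

theorem imp_falsum_neg : Provable X (imp (imp A (and B (neg B))) (neg A)) :=
  imp_mp (imp_trans (and_left B (neg B)).imp_imp_mono (neg_intro A B))
    (and_right B (neg B)).imp_imp_mono

end Provable

/-! ### The Lindenbaum algebra -/

/-- Formulas preordered by reverse provable implication in `IPC + X`. -/
def PreLindenbaum (_ : Set Formula) : Type := Formula

instance (X : Set Formula) : Preorder (PreLindenbaum X) where
  le A B := Provable X (imp B A)
  le_refl A := Provable.imp_refl A
  le_trans _ _ _ h₁ h₂ := Provable.imp_trans h₂ h₁

/-- The Lindenbaum algebra of `IPC + X`, with the order of a Brouwer algebra. -/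
def Lindenbaum (X : Set Formula) : Type :=
  Antisymmetrization (PreLindenbaum X) (· ≤ ·)

namespace Lindenbaum

variable {X : Set Formula}

instance : PartialOrder (Lindenbaum X) :=
  inferInstanceAs (PartialOrder (Antisymmetrization (PreLindenbaum X) (· ≤ ·)))

/-- The class of a formula in the Lindenbaum algebra. -/
def mk (X : Set Formula) (A : Formula) : Lindenbaum X :=
  toAntisymmetrization (α := PreLindenbaum X) (· ≤ ·) A

theorem mk_le_mk {A B : Formula} : mk X A ≤ mk X B ↔ Provable X (imp B A) := Iff.rfl

theorem mk_surjective : Function.Surjective (mk X) := Quotient.mk_surjective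

/-- A representative of an element of the Lindenbaum algebra. -/
noncomputable def out (a : Lindenbaum X) : Formula := (mk_surjective a).choose

@[simp] theorem mk_out (a : Lindenbaum X) : mk X a.out = a := (mk_surjective a).choose_spec

theorem le_iff {a b : Lindenbaum X} : a ≤ b ↔ Provable X (imp b.out a.out) := by
  rw [← mk_le_mk, mk_out, mk_out]

theorem mk_le_iff {A : Formula} {b : Lindenbaum X} : mk X A ≤ b ↔ Provable X (imp b.out A) := by
  rw [← mk_le_mk, mk_out]

theorem le_mk_iff {A : Formula} {b : Lindenbaum X} : b ≤ mk X A ↔ Provable X (imp A b.out) := by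
  rw [← mk_le_mk, mk_out]

noncomputable instance : CoheytingAlgebra (Lindenbaum X) where
  sup a b := mk X (and a.out b.out)
  inf a b := mk X (or a.out b.out)
  sdiff a b := mk X (imp b.out a.out)
  hnot a := mk X (neg a.out)
  top := mk X (and (var 0) (neg (var 0)))
  bot := mk X (imp (var 0) (var 0))
  le_sup_left _ _ := le_mk_iff.2 (Provable.and_left _ _)
  le_sup_right _ _ := le_mk_iff.2 (Provable.and_right _ _)
  sup_le _ _ _ h₁ h₂ := mk_le_iff.2 (Provable.imp_and (le_iff.1 h₁) (le_iff.1 h₂))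
  inf_le_left _ _ := mk_le_iff.2 (Provable.or_left _ _)
  inf_le_right _ _ := mk_le_iff.2 (Provable.or_right _ _)
  le_inf _ _ _ h₁ h₂ := le_mk_iff.2 (Provable.or_imp (le_iff.1 h₁) (le_iff.1 h₂))
  le_top _ := le_mk_iff.2 Provable.falsum_imp
  bot_le _ := mk_le_iff.2 (Provable.imp_refl _).weaken
  sdiff_le_iff _ _ _ := (mk_le_iff.trans Provable.imp_imp_iff).trans le_mk_iff.symm
  top_sdiff a := by
    apply le_antisymm
    · refine mk_le_mk.2 (Provable.imp_trans Provable.neg_imp_falsum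
        (Provable.imp_imp_mono (le_mk_iff.1 le_rfl)))
    · refine mk_le_mk.2 (Provable.imp_trans
        (Provable.imp_imp_mono (mk_le_iff.1 le_rfl)) Provable.imp_falsum_neg)

theorem mk_out_imp (A : Formula) : Provable X (imp (mk X A).out A) := mk_le_iff.1 le_rfl

theorem imp_mk_out (A : Formula) : Provable X (imp A (mk X A).out) := le_mk_iff.1 le_rfl

theorem mk_and (A B : Formula) : mk X (and A B) = mk X A ⊔ mk X B :=
  le_antisymm
    (mk_le_mk.2 (Provable.imp_and (Provable.imp_trans (Provable.and_left _ _) (mk_out_imp A))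
      (Provable.imp_trans (Provable.and_right _ _) (mk_out_imp B))))
    (sup_le (mk_le_mk.2 (Provable.and_left _ _)) (mk_le_mk.2 (Provable.and_right _ _)))

theorem mk_or (A B : Formula) : mk X (or A B) = mk X A ⊓ mk X B :=
  le_antisymm
    (le_inf (mk_le_mk.2 (Provable.or_left _ _)) (mk_le_mk.2 (Provable.or_right _ _)))
    (mk_le_mk.2 (Provable.or_imp (Provable.imp_trans (imp_mk_out A) (Provable.or_left _ _))
      (Provable.imp_trans (imp_mk_out B) (Provable.or_right _ _))))

theorem mk_imp (A B : Formula) : mk X (imp A B) = mk X B \ mk X A := by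
  refine eq_of_forall_ge_iff fun c => ?_
  obtain ⟨C, rfl⟩ := mk_surjective c
  rw [sdiff_le_iff, ← mk_and, mk_le_mk, mk_le_mk]
  exact Provable.imp_imp_iff

theorem mk_neg (A : Formula) : mk X (neg A) = ￢mk X A := by
  rw [← top_sdiff']
  refine Eq.trans ?_ (mk_imp A (and (var 0) (neg (var 0))))
  exact le_antisymm (mk_le_mk.2 Provable.imp_falsum_neg) (mk_le_mk.2 Provable.neg_imp_falsum)

theorem mk_eq_bot {A : Formula} : mk X A = ⊥ ↔ Provable X A := by
  rw [eq_bot_iff]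
  exact ⟨fun h => .mp _ _ (mk_le_mk.1 h) (Provable.imp_refl _), fun h => mk_le_mk.2 h.weaken⟩

theorem eval_mk (s : ℕ → Formula) (A : Formula) :
    A.eval (fun i => mk X (s i)) = mk X (A.subst s) := by
  induction A with
  | var i => rfl
  | and A B hA hB => simp only [eval, subst, hA, hB, mk_and]
  | or A B hA hB => simp only [eval, subst, hA, hB, mk_or]
  | imp A B hA hB => simp only [eval, subst, hA, hB, mk_imp]
  | neg A hA => simp only [eval, subst, hA, mk_neg]

/-- Evaluating at classes of formulas amounts to substituting them, and every substitution instance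
of a member of `X` is an axiom. -/
theorem satisfies {A : Formula} (hA : A ∈ X) : Satisfies (Lindenbaum X) A := fun v => by
  have h := eval_mk (X := X) (fun i => (v i).out) A
  simp only [mk_out] at h
  exact h.trans (mk_eq_bot.2 (.extra A _ hA))

end Lindenbaum

theorem subst_var (A : Formula) : A.subst var = A := by
  induction A with
  | var i => rfl
  | and A B hA hB => simp only [subst, hA, hB]
  | or A B hA hB => simp only [subst, hA, hB]
  | imp A B hA hB => simp only [subst, hA, hB]
  | neg A hA => simp only [subst, hA]

theorem exists_eval_ne_bot {X : Set Formula} {A : Formula} (h : ¬ Provable X A) :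
    ∃ v : ℕ → Lindenbaum X, A.eval v ≠ ⊥ :=
  ⟨fun i => .mk X (var i), by rwa [Lindenbaum.eval_mk, subst_var, Ne, Lindenbaum.mk_eq_bot]⟩

/-! ### Soundness in Brouwer algebras -/

section Soundness

variable {L : Type*} [CoheytingAlgebra L]

theorem eval_subst (v : ℕ → L) (s : ℕ → Formula) (A : Formula) :
    (A.subst s).eval v = A.eval (fun i => (s i).eval v) := by
  induction A with
  | var i => rfl
  | and A B hA hB => simp only [eval, subst, hA, hB]
  | or A B hA hB => simp only [eval, subst, hA, hB]
  | imp A B hA hB => simp only [eval, subst, hA, hB]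
  | neg A hA => simp only [eval, subst, hA]

theorem satisfies_of_provable {X : Set Formula} (hX : ∀ B ∈ X, Satisfies L B) {A : Formula}
    (h : Provable X A) : Satisfies L A := by
  intro v
  induction h with
  | imp_weaken A B =>
    simp only [eval, sdiff_eq_bot_iff, sdiff_le_iff]
    exact le_sup_right
  | imp_distrib A B C =>
    simp only [eval, sdiff_eq_bot_iff, sdiff_le_iff]
    set a := A.eval v
    set b := B.eval v
    set c := C.eval v
    have h₁ : b ≤ a ⊔ b \ a := le_sup_sdiff
    have h₂ : c \ b ≤ a ⊔ (c \ b) \ a := le_sup_sdiff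
    have h₃ : c ≤ b ⊔ c \ b := le_sup_sdiff
    refine h₃.trans (sup_le ?_ ?_)
    · exact h₁.trans (sup_le le_sup_left (le_sup_of_le_right le_sup_left))
    · exact h₂.trans (sup_le le_sup_left (le_sup_of_le_right le_sup_right))
  | and_left A B => simp [eval]
  | and_right A B => simp [eval]
  | and_intro A B =>
    simp only [eval, sdiff_eq_bot_iff, sdiff_le_iff]
    exact sup_le le_sup_right le_sup_left
  | or_left A B => simp [eval]
  | or_right A B => simp [eval]
  | or_elim A B C =>
    simp only [eval, sdiff_eq_bot_iff, sdiff_le_iff]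
    set a := A.eval v
    set b := B.eval v
    set c := C.eval v
    have h₁ : c ≤ a ⊔ c \ a := le_sup_sdiff
    have h₂ : c ≤ b ⊔ c \ b := le_sup_sdiff
    rw [sup_inf_right]
    refine le_inf (h₁.trans ?_) (h₂.trans ?_)
    · exact sup_le le_sup_left (le_sup_of_le_right le_sup_right)
    · exact sup_le le_sup_left (le_sup_of_le_right le_sup_left)
  | neg_intro A B =>
    simp only [eval, sdiff_eq_bot_iff, sdiff_le_iff, hnot_le_iff_codisjoint_left,
      codisjoint_iff_le_sup]
    set a := A.eval v
    set b := B.eval v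
    have h₁ : b ≤ a ⊔ b \ a := le_sup_sdiff
    have h₂ : ￢b ≤ a ⊔ ￢b \ a := le_sup_sdiff
    have h₃ : ⊤ ≤ b ⊔ ￢b := sup_hnot_self b |>.ge
    refine h₃.trans (sup_le (h₁.trans ?_) (h₂.trans ?_))
    · exact sup_le le_sup_right (le_sup_of_le_left le_sup_right)
    · exact sup_le le_sup_right (le_sup_of_le_left le_sup_left)
  | neg_elim A B =>
    simp [eval]
  | extra A s hA => rw [eval_subst]; exact hX A hA _
  | mp A B _ _ h₁ h₂ =>
    simp only [eval, h₂, sdiff_bot] at h₁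
    exact h₁

/-! ### Values of `φₖ` -/

/-- Stated for ideals so as to cover both the principal ideal of a coatom (soundness) and maximal
ideals (completeness). -/
theorem eval_negConj_mem_iff (v : ℕ → L) (I : Ideal L) {k : ℕ} (hk : 1 ≤ k) :
    (negConj k).eval v ∈ I ↔ ∀ i < k, ￢v i ∈ I := by
  have key : ∀ (l : List ℕ) (B : Formula),
      (l.foldr (fun i A => and (neg (var i)) A) B).eval v ∈ I ↔
        (∀ i ∈ l, ￢v i ∈ I) ∧ B.eval v ∈ I := by
    intro l B
    induction l with
    | nil => simp
    | cons a l ih => simp [eval, ih, and_assoc]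
  rw [negConj, key]
  simp only [List.mem_range, eval]
  constructor
  · rintro ⟨h₁, h₂⟩ i hi
    rcases Nat.lt_or_ge i (k - 1) with h | h
    · exact h₁ i h
    · rwa [show i = k - 1 by omega]
  · exact fun h => ⟨fun i hi => h i (by omega), h _ (by omega)⟩

theorem mem_negImps {k : ℕ} {B : Formula} :
    B ∈ negImps k ↔ ∃ i < k, ∃ j < k, i ≠ j ∧ imp (neg (var i)) (neg (var j)) = B := by
  simp only [negImps, List.mem_map, List.mem_filter, Prod.exists, decide_eq_true_eq]
  constructor
  · rintro ⟨i, j, ⟨h, hij⟩, rfl⟩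
    obtain ⟨hi, hj⟩ := List.pair_mem_product.1 h
    exact ⟨i, List.mem_range.1 hi, j, List.mem_range.1 hj, hij, rfl⟩
  · rintro ⟨i, hi, j, hj, hij, rfl⟩
    exact ⟨i, j, ⟨List.pair_mem_product.2 ⟨List.mem_range.2 hi, List.mem_range.2 hj⟩, hij⟩, rfl⟩

theorem eval_foldr_or_le (v : ℕ → L) (l : List Formula) (B : Formula) :
    (l.foldr Formula.or B).eval v ≤ B.eval v ∧ ∀ C ∈ l, (l.foldr Formula.or B).eval v ≤ C.eval v := by
  induction l with
  | nil => simp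
  | cons a l ih =>
    simp only [List.foldr_cons, eval, List.mem_cons, forall_eq_or_imp]
    exact ⟨inf_le_of_right_le ih.1, inf_le_left, fun C hC => inf_le_of_right_le (ih.2 C hC)⟩

theorem mem_of_eval_foldr_or_mem (v : ℕ → L) {P : Ideal L} (hP : P.IsPrime) {l : List Formula}
    {B : Formula} (h : (l.foldr Formula.or B).eval v ∈ P) :
    B.eval v ∈ P ∨ ∃ C ∈ l, C.eval v ∈ P := by
  induction l with
  | nil => exact .inl h
  | cons a l ih =>
    rcases hP.mem_or_mem h with h | h
    · exact .inr ⟨a, List.mem_cons_self, h⟩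
    · rcases ih h with h | ⟨C, hC, h⟩
      · exact .inl h
      · exact .inr ⟨C, List.mem_cons_of_mem _ hC, h⟩

theorem hnot_le_of_not_le {c a : L} (hc : IsCoatom c) (h : ¬ a ≤ c) : ￢a ≤ c := by
  rw [hnot_le_iff_codisjoint_left, codisjoint_iff]
  exact hc.2 _ (left_lt_sup.2 h)

theorem hnot_le_iff_not_le {c a : L} (hc : IsCoatom c) : ￢a ≤ c ↔ ¬ a ≤ c := by
  refine ⟨fun h₁ h₂ => hc.1 ?_, hnot_le_of_not_le hc⟩
  rw [eq_top_iff, ← sup_hnot_self a]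
  exact sup_le h₂ h₁

/-- The inequality `￢b ≤ ￢a` means `￢a ⊔ b = ⊤`. If it fails, some coatom lies above `￢a` and `b`,
hence not above `￢b`. -/
theorem exists_isCoatom_of_not_hnot_le_hnot [Finite L] {a b : L} (h : ¬ ￢b ≤ ￢a) :
    ∃ c, IsCoatom c ∧ ￢a ≤ c ∧ ¬ ￢b ≤ c := by
  rw [hnot_le_iff_codisjoint_right, codisjoint_iff, sup_comm] at h
  obtain ⟨c, hc, hle⟩ := (eq_top_or_exists_le_coatom _).resolve_left h
  refine ⟨c, hc, le_sup_left.trans hle, ?_⟩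
  rw [hnot_le_iff_not_le hc, not_not]
  exact le_sup_right.trans hle

theorem satisfies_phi_one [Finite L] (hL : {a : L | IsCoatom a}.ncard ≤ 1) :
    Satisfies L (phi 1) := by
  intro v
  have hphi : (phi 1).eval v = ￢v 0 ⊓ ￢￢v 0 := rfl
  rw [hphi]
  by_cases h : v 0 = ⊤
  · simp [h]
  by_cases h' : ￢v 0 = ⊤
  · simp [h']
  obtain ⟨c, hc, hvc⟩ := (eq_top_or_exists_le_coatom _).resolve_left h
  obtain ⟨d, hd, hvd⟩ := (eq_top_or_exists_le_coatom _).resolve_left h'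
  have hcd : c = d := (Set.ncard_le_one_iff (Set.toFinite _)).1 hL hc hd
  exact absurd hvc ((hnot_le_iff_not_le hc).1 (hcd ▸ hvd))

theorem le_choose_of_eval_phi_ne_bot [Finite L] {k : ℕ} (hk : 2 ≤ k) {v : ℕ → L}
    (h : (phi k).eval v ≠ ⊥) :
    ∃ m < {a : L | IsCoatom a}.ncard, k ≤ m.choose (m / 2) := by
  classical
  rw [phi, if_neg (by omega)] at h
  obtain ⟨h₁, h₂⟩ := eval_foldr_or_le v (negImps k) (neg (negConj k))
  have himp : ∀ i < k, ∀ j < k, i ≠ j → ∃ c, IsCoatom c ∧ ￢v i ≤ c ∧ ¬ ￢v j ≤ c := by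
    intro i hi j hj hij
    apply exists_isCoatom_of_not_hnot_le_hnot
    intro hle
    have := h₂ _ (mem_negImps.2 ⟨i, hi, j, hj, hij, rfl⟩)
    simp only [eval, sdiff_eq_bot_iff.2 hle] at this
    exact h (le_bot_iff.1 this)
  have hconj : (negConj k).eval v ≠ ⊤ := fun htop => by
    simp only [eval, htop, hnot_top] at h₁
    exact h (le_bot_iff.1 h₁)
  obtain ⟨c₀, hc₀, hle⟩ := (eq_top_or_exists_le_coatom _).resolve_left hconj
  have hle' : ∀ i < k, ￢v i ≤ c₀ :=
    (eval_negConj_mem_iff v (.principal c₀) (by omega)).1 hle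
  have := Fintype.ofFinite L
  -- Every `￢v i` is below `c₀`, so `c₀` separates no two of them: discarding it preserves the
  -- antichain and gains one point in Sperner's bound.
  let D := {c : {a : L // IsCoatom a} // c ≠ ⟨c₀, hc₀⟩}
  let F : Fin k → Finset D := fun i => Finset.univ.filter fun c => ￢v i ≤ c.1.1
  have hF : ∀ i j, i ≠ j → ¬ F i ⊆ F j := by
    intro i j hij hsub
    obtain ⟨c, hc, hi, hj⟩ := himp i i.2 j j.2 (Fin.val_ne_iff.2 hij)
    have hne : (⟨c, hc⟩ : {a : L // IsCoatom a}) ≠ ⟨c₀, hc₀⟩ := by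
      intro heq
      exact hj ((hle' j j.2).trans_eq (Subtype.ext_iff.1 heq).symm)
    have hmem : (⟨⟨c, hc⟩, hne⟩ : D) ∈ F i := by simpa [F] using hi
    exact hj (by simpa [F] using hsub hmem)
  have hinj : Function.Injective F := fun i j hij => by
    by_contra hne
    exact hF i j hne hij.le
  have hanti : IsAntichain (· ⊆ ·) ((Finset.univ.image F : Finset (Finset D)) : Set (Finset D)) := by
    simp only [Finset.coe_image, Finset.coe_univ, Set.image_univ]
    rintro _ ⟨i, rfl⟩ _ ⟨j, rfl⟩ hne
    exact hF i j (fun hij => hne (hij ▸ rfl))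
  have hcard := hanti.sperner
  rw [Finset.card_image_of_injective _ hinj, Finset.card_univ, Fintype.card_fin] at hcard
  refine ⟨Fintype.card D, ?_, hcard⟩
  rw [Set.ncard_eq_toFinset_card', Set.toFinset_card]
  exact Fintype.card_subtype_lt (x := (⟨c₀, hc₀⟩ : {a : L // IsCoatom a})) (by simp)

theorem satisfies_phi [Finite L] {k n : ℕ} (hk : 1 ≤ k)
    (hn : IsLeast {m : ℕ | 1 ≤ m ∧ k ≤ m.choose (m / 2)} n)
    (hL : {a : L | IsCoatom a}.ncard ≤ n) : Satisfies L (phi k) := by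
  obtain rfl | hk := hk.eq_or_lt
  · exact satisfies_phi_one (hL.trans (hn.2 ⟨le_rfl, by simp⟩))
  intro v
  by_contra h
  obtain ⟨m, hm, hkm⟩ := le_choose_of_eval_phi_ne_bot hk h
  -- Minimality of `n` concerns positive `m` only; `m = 0` would force `k ≤ 1`.
  rcases Nat.eq_zero_or_pos m with rfl | hm0
  · simp at hkm
    omega
  · have := hn.2 ⟨hm0, hkm⟩
    omega

end Soundness

/-! ### Maximal ideals above a prime ideal -/

section Ideals

variable {L : Type*} [CoheytingAlgebra L]

theorem hnot_mem_iff {M : Ideal L} (hM : M.IsMaximal) {a : L} : ￢a ∈ M ↔ a ∉ M := by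
  have htop : (⊤ : L) ∉ M := Ideal.isProper_iff_top_notMem.1 hM.toIsProper
  constructor
  · intro h₁ h₂
    exact htop (sup_hnot_self a ▸ Ideal.sup_mem h₂ h₁)
  · intro h
    have h₁ := hM.maximal_proper (Ideal.lt_sup_principal_of_notMem h)
    have h₂ : (⊤ : L) ∈ M ⊔ Ideal.principal a := by
      rw [← SetLike.mem_coe, h₁]; trivial
    obtain ⟨j, hj, hle⟩ := (Lattice.mem_ideal_sup_principal a ⊤ M).1 h₂
    refine M.lower ?_ hj
    rwa [hnot_le_iff_codisjoint_left, codisjoint_iff_le_sup]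

theorem exists_isPrime_of_notMem {I : Ideal L} {a : L} (h : a ∉ I) :
    ∃ P : Ideal L, P.IsPrime ∧ I ≤ P ∧ a ∉ P := by
  obtain ⟨P, hP, hIP, hd⟩ := DistribLattice.prime_ideal_of_disjoint_filter_ideal
    (F := PFilter.principal a) (I := I) (by
      rw [Set.disjoint_left]
      intro x hx hxI
      exact h (I.lower (PFilter.mem_principal.1 hx) hxI))
  exact ⟨P, hP, hIP, Set.disjoint_left.1 hd (PFilter.mem_principal.2 le_rfl)⟩

theorem exists_isPrime_of_sdiff_notMem {I : Ideal L} {a b : L} (h : b \ a ∉ I) :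
    ∃ P : Ideal L, P.IsPrime ∧ I ≤ P ∧ a ∈ P ∧ b ∉ P := by
  have h' : b ∉ I ⊔ Ideal.principal a := by
    rw [Lattice.mem_ideal_sup_principal]
    rintro ⟨j, hj, hle⟩
    exact h (I.lower (sdiff_le_iff.2 (by rwa [sup_comm])) hj)
  obtain ⟨P, hP, hle, hb⟩ := exists_isPrime_of_notMem h'
  exact ⟨P, hP, le_sup_left.trans hle, hle (le_sup_right (a := I) (Ideal.mem_principal_self)), hb⟩

theorem finset_inf_mem_iff {P : Ideal L} (hP : P.IsPrime) {ι : Type*} (s : Finset ι) (f : ι → L) :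
    s.inf f ∈ P ↔ ∃ i ∈ s, f i ∈ P := by
  classical
  constructor
  · induction s using Finset.induction_on with
    | empty =>
      intro h
      exact absurd h (Ideal.isProper_iff_top_notMem.1 hP.toIsProper)
    | insert a s _ ih =>
      rw [Finset.inf_insert]
      intro h
      rcases hP.mem_or_mem h with h | h
      · exact ⟨a, Finset.mem_insert_self _ _, h⟩
      · obtain ⟨i, hi, h⟩ := ih h
        exact ⟨i, Finset.mem_insert_of_mem hi, h⟩
  · rintro ⟨i, hi, h⟩
    exact P.lower (Finset.inf_le hi) h

/-- Finitely many distinct maximal ideals can be separated by elements in any prescribed way. -/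
theorem exists_mem_iff_mem {ι : Type*} [Finite ι] {M : ι → Ideal L} (hM : ∀ i, (M i).IsMaximal)
    (hinj : Function.Injective M) (S : Set ι) : ∃ a : L, ∀ i, a ∈ M i ↔ i ∈ S := by
  classical
  have := Fintype.ofFinite ι
  have hsep : ∀ i j, ∃ b, b ∈ M i ∧ (i ≠ j → b ∉ M j) := by
    intro i j
    by_cases hij : i = j
    · exact ⟨⊥, (M i).bot_mem, fun h => absurd hij h⟩
    · have hle : ¬ M i ≤ M j := fun hle =>
        hij (hinj (((hM i).isCoatom.le_iff_eq (hM j).isCoatom.1).1 hle).symm)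
      obtain ⟨b, hb, hb'⟩ := Set.not_subset.1 hle
      exact ⟨b, hb, fun _ => hb'⟩
  choose b hb hb' using hsep
  -- For fixed `i`, the join of all `b i j` lies in `M i` and in no other `M j`; primality then
  -- handles the meet over `S`.
  refine ⟨(Finset.univ.filter (· ∈ S)).inf fun i => Finset.univ.sup (b i), fun j => ?_⟩
  have := hM j
  rw [finset_inf_mem_iff inferInstance]
  simp only [Finset.mem_filter, Finset.mem_univ, true_and, Ideal.finsetSup_mem_iff,
    forall_const]
  constructor
  · rintro ⟨i, hi, h⟩
    by_contra hj
    exact hb' i j (fun hij => hj (hij ▸ hi)) (h j)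
  · exact fun hj => ⟨j, hj, fun i => hb j i⟩

/-- Converse to the Sperner bound: the middle layer of the subsets of `Fin n` provides `k`
incomparable sets, and adding one common point makes the last disjunct of `phi k` fail as well. -/
theorem not_injective_of_satisfies_phi {k n : ℕ} (hk : 1 ≤ k) (hn1 : 1 ≤ n)
    (hn : k ≤ n.choose (n / 2)) (hL : Satisfies L (phi k)) {P : Ideal L} (hP : P.IsPrime)
    {M : Fin (n + 1) → Ideal L} (hM : ∀ i, (M i).IsMaximal) (hPM : ∀ i, P ≤ M i) :
    ¬ Function.Injective M := by
  classical
  intro hinj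
  obtain rfl | hk := hk.eq_or_lt
  · obtain ⟨a, ha⟩ := exists_mem_iff_mem hM hinj {0}
    let l : Fin (n + 1) := Fin.last n
    have hl : l ≠ 0 := by
      intro h
      have := congrArg Fin.val h
      simp [l] at this
      omega
    have h : ￢a ⊓ ￢￢a ∈ P := by
      have : ￢a ⊓ ￢￢a = ⊥ := hL fun _ => a
      rw [this]; exact P.bot_mem
    rcases hP.mem_or_mem h with h | h
    · exact (hnot_mem_iff (hM 0)).1 (hPM 0 h) ((ha 0).2 rfl)
    · exact (hnot_mem_iff (hM l)).1 (hPM l h)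
        ((hnot_mem_iff (hM l)).2 fun h => hl ((ha l).1 h))
  · have hcard : Fintype.card (Fin k) ≤
        Fintype.card (Finset.powersetCard (n / 2) (Finset.univ : Finset (Fin n))) := by
      simpa using hn
    obtain ⟨e⟩ := Function.Embedding.nonempty_of_card_le hcard
    let S : Fin k → Set (Fin (n + 1)) := fun i => {m | m = 0 ∨ ∃ t ∈ (e i).1, m = Fin.succ t}
    have hS : ∀ i j, i ≠ j → ∃ m, m ∈ S i ∧ m ∉ S j := by
      intro i j hij
      have hne : ¬ (e i).1 ⊆ (e j).1 := fun hsub => hij <| e.injective <| Subtype.ext <|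
        Finset.eq_of_subset_of_card_le hsub <| by
          rw [(Finset.mem_powersetCard.1 (e i).2).2, (Finset.mem_powersetCard.1 (e j).2).2]
      obtain ⟨t, ht, ht'⟩ := Finset.not_subset.1 hne
      refine ⟨t.succ, .inr ⟨t, ht, rfl⟩, ?_⟩
      rintro (h | ⟨t', h, heq⟩)
      · exact Fin.succ_ne_zero _ h
      · exact ht' (Fin.succ_injective _ heq ▸ h)
    -- Complements, because it is `￢a i` that must lie in exactly the `M m` with `m ∈ S i`.
    choose a ha using fun i => exists_mem_iff_mem hM hinj (S i)ᶜ
    have ha' : ∀ i m, ￢a i ∈ M m ↔ m ∈ S i := fun i m => by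
      rw [hnot_mem_iff (hM m), ha, Set.mem_compl_iff, not_not]
    let v : ℕ → L := fun i => if h : i < k then a ⟨i, h⟩ else ⊥
    have hv : ∀ i (h : i < k), v i = a ⟨i, h⟩ := fun i h => dif_pos h
    have h : (phi k).eval v ∈ P := by
      rw [hL v]; exact P.bot_mem
    rw [phi, if_neg (by omega)] at h
    rcases mem_of_eval_foldr_or_mem v hP h with h | ⟨C, hC, h⟩
    · refine (hnot_mem_iff (hM 0)).1 (hPM 0 (show ￢(negConj k).eval v ∈ P from h))
        ((eval_negConj_mem_iff v (M 0) (by omega)).2 fun i hi => ?_)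
      rw [hv i hi, ha']
      exact .inl rfl
    · obtain ⟨i, hi, j, hj, hij, rfl⟩ := mem_negImps.1 hC
      simp only [eval, hv i hi, hv j hj] at h
      obtain ⟨m, hmi, hmj⟩ := hS ⟨i, hi⟩ ⟨j, hj⟩ (by simpa using hij)
      refine hmj ((ha' _ m).1 ((M m).lower le_sup_sdiff
        (Ideal.sup_mem ((ha' _ m).2 hmi) (hPM m h))))

end Ideals

/-! ### Up-sets of a finite rooted frame -/

section UpperSet

variable {K : Type*} [PartialOrder K]

/-- `UpperSet` is ordered by reverse inclusion: `⊥` is the whole frame, `⊤` is empty, and membership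
is Kripke forcing. -/
theorem mem_sdiff_upperSet {a b : UpperSet K} {x : K} :
    x ∈ b \ a ↔ ∀ y, x ≤ y → y ∈ a → y ∈ b := by
  rw [← UpperSet.le_Ici, sdiff_le_iff]
  constructor
  · intro h y hxy hy
    exact h (UpperSet.mem_sup_iff.2 ⟨hy, UpperSet.mem_Ici_iff.2 hxy⟩)
  · intro h y hy
    obtain ⟨h₁, h₂⟩ := UpperSet.mem_sup_iff.1 hy
    exact h y (UpperSet.mem_Ici_iff.1 h₂) h₁

theorem mem_hnot_upperSet {a : UpperSet K} {x : K} : x ∈ ￢a ↔ ∀ y, x ≤ y → y ∉ a := by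
  rw [← top_sdiff', mem_sdiff_upperSet]
  simp only [UpperSet.notMem_top]

theorem infIrred_bot_upperSet {r : K} (hr : ∀ x, r ≤ x) : InfIrred (⊥ : UpperSet K) := by
  have key : ∀ a : UpperSet K, r ∈ a → a = ⊥ := fun a h =>
    le_bot_iff.1 fun x _ => a.upper (hr x) h
  refine ⟨?_, fun a b hab => ?_⟩
  · rw [isMax_iff_eq_top]
    intro h
    exact UpperSet.notMem_top (h ▸ UpperSet.mem_bot : r ∈ (⊤ : UpperSet K))
  · have h : r ∈ a ⊓ b := hab ▸ UpperSet.mem_bot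
    exact (UpperSet.mem_inf_iff.1 h).imp (key a) (key b)

theorem eq_Ici_of_isCoatom {c : UpperSet K} (hc : IsCoatom c) {x : K} (hx : x ∈ c) :
    c = UpperSet.Ici x :=
  (hc.le_iff_eq UpperSet.Ici_ne_top).1 (UpperSet.le_Ici.2 hx) |>.symm

end UpperSet

/-! ### Filtration -/

/-- The set of subformulas of a formula. -/
def Formula.subformulas : Formula → Set Formula
  | var i => {var i}
  | and A B => insert (and A B) (A.subformulas ∪ B.subformulas)
  | or A B => insert (or A B) (A.subformulas ∪ B.subformulas)
  | imp A B => insert (imp A B) (A.subformulas ∪ B.subformulas)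
  | neg A => insert (neg A) A.subformulas

theorem finite_subformulas (A : Formula) : A.subformulas.Finite := by
  induction A with
  | var i => exact Set.finite_singleton _
  | and A B hA hB => exact (hA.union hB).insert _
  | or A B hA hB => exact (hA.union hB).insert _
  | imp A B hA hB => exact (hA.union hB).insert _
  | neg A hA => exact hA.insert _

section Filtration

variable {L : Type*} [CoheytingAlgebra L]

/-- The formulas of `Γ` whose value belongs to the ideal `I`. -/
def theoryIn (v : ℕ → L) (Γ : Set Formula) (I : Ideal L) : Set Formula :=
  {B ∈ Γ | B.eval v ∈ I}

/-- The theories, within `Γ`, of the prime ideals that contain `P`. -/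
def Filtration (v : ℕ → L) (Γ : Set Formula) (P : Ideal L) : Type :=
  {T : Set Formula // ∃ Q : Ideal L, Q.IsPrime ∧ P ≤ Q ∧ theoryIn v Γ Q = T}

namespace Filtration

variable {v : ℕ → L} {Γ : Set Formula} {P : Ideal L}

instance : PartialOrder (Filtration v Γ P) :=
  inferInstanceAs (PartialOrder {_T : Set Formula // _})

/-- The world given by a prime ideal that contains `P`. -/
def world (v : ℕ → L) (Γ : Set Formula) {P Q : Ideal L} (hQ : Q.IsPrime) (hPQ : P ≤ Q) :
    Filtration v Γ P :=
  ⟨theoryIn v Γ Q, Q, hQ, hPQ, rfl⟩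

theorem exists_eq_world (x : Filtration v Γ P) :
    ∃ (Q : Ideal L) (hQ : Q.IsPrime) (hPQ : P ≤ Q), x = world v Γ hQ hPQ := by
  obtain ⟨_, Q, hQ, hPQ, rfl⟩ := x
  exact ⟨Q, hQ, hPQ, rfl⟩

theorem world_mono {Q R : Ideal L} (hQ : Q.IsPrime) (hPQ : P ≤ Q) (hR : R.IsPrime) (hPR : P ≤ R)
    (h : Q ≤ R) : world v Γ hQ hPQ ≤ world v Γ hR hPR :=
  fun _ hB => ⟨hB.1, h hB.2⟩

theorem finite (hΓ : Γ.Finite) : Finite (Filtration v Γ P) := by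
  have : Finite {T : Set Formula // T ⊆ Γ} := hΓ.finite_subsets.to_subtype
  refine Finite.of_injective
    (fun x : Filtration v Γ P => (⟨x.1, ?_⟩ : {T : Set Formula // T ⊆ Γ})) ?_
  · obtain ⟨Q, _, _, h⟩ := x.2
    rw [← h]
    exact Set.sep_subset _ _
  · intro x y h
    exact Subtype.ext (congrArg (fun T : {T : Set Formula // T ⊆ Γ} => T.1) h)

/-- The valuation in the up-sets of the filtration. -/
def val (v : ℕ → L) (Γ : Set Formula) (P : Ideal L) (i : ℕ) :
    UpperSet (ULift.{u} (Filtration v Γ P)) where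
  carrier := {x | var i ∈ x.down.1}
  upper' _ _ hxy hx := hxy hx

/-- The truth lemma. Worlds are ordered by inclusion of theories, not of ideals, so an implication
or negation passes to a later world only because it belongs to `Γ` itself. -/
theorem mem_eval_iff {B : Formula} (hB : B.subformulas ⊆ Γ) {Q : Ideal L} (hQ : Q.IsPrime)
    (hPQ : P ≤ Q) :
    ULift.up (world v Γ hQ hPQ) ∈ B.eval (val.{u} v Γ P) ↔ B.eval v ∈ Q := by
  induction B generalizing Q with
  | var i => exact and_iff_right (hB rfl)
  | and A B hA' hB' =>
    simp only [subformulas, Set.insert_subset_iff, Set.union_subset_iff] at hB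
    simp only [eval, UpperSet.mem_sup_iff, Ideal.sup_mem_iff, hA' hB.2.1, hB' hB.2.2]
  | or A B hA' hB' =>
    simp only [subformulas, Set.insert_subset_iff, Set.union_subset_iff] at hB
    simp only [eval, UpperSet.mem_inf_iff, hA' hB.2.1, hB' hB.2.2]
    exact ⟨fun h => h.elim (Q.lower inf_le_left) (Q.lower inf_le_right), hQ.mem_or_mem⟩
  | imp A B hA' hB' =>
    simp only [subformulas, Set.insert_subset_iff, Set.union_subset_iff] at hB
    simp only [eval, mem_sdiff_upperSet]
    constructor
    · intro h
      by_contra hQ'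
      obtain ⟨R, hR, hQR, hAR, hBR⟩ := exists_isPrime_of_sdiff_notMem hQ'
      exact hBR ((hB' hB.2.2 hR (hPQ.trans hQR)).1
        (h _ (world_mono hQ hPQ hR (hPQ.trans hQR) hQR)
          ((hA' hB.2.1 hR (hPQ.trans hQR)).2 hAR)))
    · rintro h ⟨y⟩ hy hyA
      obtain ⟨R, hR, hPR, rfl⟩ := exists_eq_world y
      rw [hA' hB.2.1] at hyA
      rw [hB' hB.2.2]
      have hmem : imp A B ∈ theoryIn v Γ R := hy ⟨hB.1, h⟩
      exact R.lower le_sup_sdiff (Ideal.sup_mem hyA hmem.2)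
  | neg A hA' =>
    simp only [subformulas, Set.insert_subset_iff] at hB
    simp only [eval, mem_hnot_upperSet]
    constructor
    · intro h
      by_contra hQ'
      rw [← top_sdiff'] at hQ'
      obtain ⟨R, hR, hQR, hAR, -⟩ := exists_isPrime_of_sdiff_notMem hQ'
      exact h _ (world_mono hQ hPQ hR (hPQ.trans hQR) hQR)
        ((hA' hB.2 hR (hPQ.trans hQR)).2 hAR)
    · rintro h ⟨y⟩ hy hyA
      obtain ⟨R, hR, hPR, rfl⟩ := exists_eq_world y
      rw [hA' hB.2] at hyA
      have hmem : neg A ∈ theoryIn v Γ R := hy ⟨hB.1, h⟩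
      exact Ideal.isProper_iff_top_notMem.1 hR.toIsProper
        (sup_hnot_self (A.eval v) ▸ Ideal.sup_mem hyA hmem.2)

/-- A coatom is generated by any of its points. Enlarging the prime ideal behind one point to a
maximal ideal gives a later world, still in `c`. -/
theorem exists_isMaximal_of_isCoatom {c : UpperSet (ULift.{u} (Filtration v Γ P))}
    (hc : IsCoatom c) :
    ∃ (M : Ideal L) (hM : M.IsMaximal) (hPM : P ≤ M),
      c = UpperSet.Ici (ULift.up (world v Γ hM.isPrime hPM)) := by
  obtain ⟨⟨x⟩, hx⟩ : ∃ x, x ∈ c := by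
    by_contra! h
    exact hc.1 (top_le_iff.1 fun x hx => absurd hx (h x))
  obtain ⟨Q, hQ, hPQ, rfl⟩ := exists_eq_world x
  obtain ⟨M, hQM, hM⟩ := hQ.toIsProper.exists_le_maximal
  exact ⟨M, hM, hPQ.trans hQM, eq_Ici_of_isCoatom hc
    (c.upper (world_mono hQ hPQ hM.isPrime (hPQ.trans hQM) hQM) hx)⟩

theorem ncard_isCoatom_le {k n : ℕ} (hk : 1 ≤ k) (hn1 : 1 ≤ n) (hn : k ≤ n.choose (n / 2))
    (hL : Satisfies L (phi k)) (hP : P.IsPrime) :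
    {c : UpperSet (ULift.{u} (Filtration v Γ P)) | IsCoatom c}.ncard ≤ n := by
  by_contra! h
  obtain ⟨s, hs, hcard⟩ := Set.exists_subset_card_eq (Nat.succ_le_of_lt h)
  have hfin : s.Finite := Set.finite_of_ncard_ne_zero (by omega)
  have := hfin.to_subtype
  let e : Fin (n + 1) ≃ s := (Finite.equivFinOfCardEq (by rw [Nat.card_coe_set_eq, hcard])).symm
  choose M hM hPM heq using fun i => exists_isMaximal_of_isCoatom (hs (e i).2)
  refine not_injective_of_satisfies_phi hk hn1 hn hL hP hM hPM fun i j hij => ?_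
  refine e.injective (Subtype.ext ?_)
  rw [heq i, heq j]
  congr 3

end Filtration

end Filtration

end IPL

theorem mainTheorem6 (k n : ℕ) (hk : 1 ≤ k)
    (hn : IsLeast {m : ℕ | 1 ≤ m ∧ k ≤ m.choose (m / 2)} n) (A : IPL.Formula) :
    IPL.Provable {IPL.phi k} A ↔
      ∀ (L : Type u) [CoheytingAlgebra L] [Finite L],
        InfIrred (⊥ : L) → {a : L | IsCoatom a}.ncard ≤ n → IPL.Satisfies L A := by
  constructor
  · intro h L _ _ _ hL
    refine IPL.satisfies_of_provable ?_ h
    rintro _ rfl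
    exact IPL.satisfies_phi hk hn hL
  · intro h
    by_contra hA
    obtain ⟨v, hv⟩ := IPL.exists_eval_ne_bot hA
    obtain ⟨P, hP, -, hvP⟩ := IPL.exists_isPrime_of_notMem
      (I := Order.Ideal.principal ⊥) (a := A.eval v) (by rwa [Order.Ideal.mem_principal, le_bot_iff])
    have := IPL.Filtration.finite (v := v) (P := P) (IPL.finite_subformulas A)
    -- The root is the theory of `P` itself; `ULift` moves the frame into the universe over which
    -- the algebras range.
    let r : ULift.{u} (IPL.Filtration v A.subformulas P) :=
      ⟨IPL.Filtration.world v _ hP le_rfl⟩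
    have hr : ∀ x, r ≤ x := by
      rintro ⟨x⟩
      obtain ⟨Q, hQ, hPQ, rfl⟩ := x.exists_eq_world
      exact IPL.Filtration.world_mono hP le_rfl hQ hPQ hPQ
    have : Finite (UpperSet (ULift.{u} (IPL.Filtration v A.subformulas P))) :=
      Finite.of_injective _ SetLike.coe_injective
    have hsat := h _ (IPL.infIrred_bot_upperSet hr) (IPL.Filtration.ncard_isCoatom_le hk hn.1.1
      hn.1.2 (IPL.Lindenbaum.satisfies rfl) hP) (IPL.Filtration.val v A.subformulas P)
    refine hvP ((IPL.Filtration.mem_eval_iff subset_rfl hP le_rfl).1 (?_ : r ∈ _))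
    rw [hsat]
    exact UpperSet.mem_bot
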